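/- \textbf{Setting.} Let $R$ be a commutative ring with one and $A$ an $R$-module. A \emph{directed acyclic multigraph} (DAMG) $G=(V,E)$ consists of a finite vertex set $V$ and a finite set $E$ of possibly parallel directed edges, each with a tail and a head in $V$, such that some total order $\prec$ on $V$ satisfies $\mathrm{tail}(e)\prec \mathrm{head}(e)$ for all $e\in E$. $\mathrm{Pa}^G(x)$ is the set of parents of $x$; $\mathrm{Anc}^G(x)$ and $\mathrm{Desc}^G(x)$ are the sets of vertices from which, resp. to which, there is a directed path (possibly trivial) to, resp. from, $x$; and $\mathrm{Rt}(G)=\{x\in V:\mathrm{Pa}^G(x)=\emptyset\}$ is the set of roots. For $q:E\to R$ put $q(x|y)=\sum_{e:x\to y}q(e)$. The pair $(G,q)$ is an \emph{$R$-PDAMG} if $q$ is normalized: $\sum_{x\in V}q(x|y)=1$ for every $y\in V\setminus \mathrm{Rt}(G)$. The \emph{total path weights} are defined recursively by $s(x|y)=0$ if $y\notin\mathrm{Desc}^G(x)$, $s(x|x)=1$, and $s(x|y)=\sum_{z\in\mathrm{Pa}^G(y)}s(x|z)\,q(z|y)$ if $y\in\mathrm{Desc}^G(x)\setminus\{x\}$.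 The \emph{synergy function} $v'_G:V\to A$ of a value function $v:V\to A$ is defined recursively by $v'_G(x)=v(x)-\sum_{y\in\mathrm{Anc}^G(x)\setminus\{x\}}v'_G(y)$. A vertex $z$ is \emph{weak} for $(G,v)$ if $v'_G(z)=0$; a root $r$ is a \emph{null root} for $(G,v)$ if $v'_G(x)=0$ for all $x\in\mathrm{Desc}^G(r)$. For $z\in V$ the \emph{projection} $(G^{\setminus z},q^{\setminus z})$ has vertex set $V\setminus\{z\}$; its edges are the edges $e$ of $G$ that avoid $z$, with weight $q(e)$, together with one edge $x\to y$ of weight $q(e_1)q(e_2)$ for each pair of edges $e_1:x\to z$, $e_2:z\to y$ of $G$. A synergy function $w:V\to A$ is projected to $w^{\setminus z}(x)=w(x)+q(x|z)\,w(z)$. For $S\subseteq V$, the objects $G^{\setminus S},q^{\setminus S},w^{\setminus S}$ are obtained by projecting out the elements of $S$ one after the other, and for a value function $v$ with $w=v'_G$ one puts $v^{\setminus S}(y)=\sum_{x\in\mathrm{Anc}^{G^{\setminus S}}(y)}w^{\setminus S}(x)$. The \emph{Shapley value} of $r\in\mathrm{Rt}(G)$ is $$\mathrm{Sh}^{(G,q)}_r(v):=(v'_G)^{\setminus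 (V\setminus\mathrm{Rt}(G))}(r)\in A .$$ \textbf{Theorem.} Let $(G,q)$ be an $R$-PDAMG and $v:V\to A$ a value function. The Shapley values do not depend on the order in which the non-root vertices are projected out, and they satisfy the following. \begin{enumerate} \item (Efficiency) $\sum_{r\in\mathrm{Rt}(G)}\mathrm{Sh}^{(G,q)}_r(v)=\sum_{x\in V}v'_G(x)$. \item ($R$-linearity) $\mathrm{Sh}^{(G,q)}_r(c_1v_1+c_2v_2)=c_1\mathrm{Sh}^{(G,q)}_r(v_1)+c_2\mathrm{Sh}^{(G,q)}_r(v_2)$ for all $c_1,c_2\in R$, $v_1,v_2:V\to A$ and $r\in\mathrm{Rt}(G)$. \item ($A$-linearity) $\mathrm{Sh}^{(G,q)}_r\big(\sum_{i\in I}v_i\cdot a_i\big)=\sum_{i\in I}\mathrm{Sh}^{(G,q)}_r(v_i)\cdot a_i$ for every finite index set $I$, $a_i\in A$, $v_i:V\to R$ and $r\in\mathrm{Rt}(G)$. \item (Null root) If $r$ is a null root for $(G,v)$, then $\mathrm{Sh}^{(G,q)}_r(v)=0$. \item (Projection) For every $S\subseteq V\setminus\mathrm{Rt}(G)$, projected out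 in any order, $(G^{\setminus S},q^{\setminus S})$ is an $R$-PDAMG with $\mathrm{Rt}(G^{\setminus S})=\mathrm{Rt}(G)$, and $\mathrm{Sh}^{(G,q)}_r(v)=\mathrm{Sh}^{(G^{\setminus S},q^{\setminus S})}_r(v^{\setminus S})$ for every $r\in\mathrm{Rt}(G)$. \item (Weak elements) If $W\subseteq V\setminus\mathrm{Rt}(G)$ consists of weak elements for $(G,v)$, then, for projecting out $W$ in any order, $v^{\setminus W}=v|_{V\setminus W}$ and $\mathrm{Sh}^{(G,q)}_r(v)=\mathrm{Sh}^{(G^{\setminus W},q^{\setminus W})}_r(v|_{V\setminus W})$ for every $r\in\mathrm{Rt}(G)$. \item (Total path weights) $\mathrm{Sh}^{(G,q)}_r(v)=\sum_{y\in V}s(r|y)\cdot v'_G(y)$ for every $r\in\mathrm{Rt}(G)$; moreover $\sum_{r\in\mathrm{Rt}(G)}s(r|y)=1$ for every $y\in V$, and $s(r|y)=0$ whenever $r\in\mathrm{Rt}(G)$ and $y\notin\mathrm{Desc}^G(r)$. \item (Symmetry) Let $\alpha$ be an automorphism of $(G,q)$, that is, a pair of bijections of $V$ and of $E$ compatible with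 tails, heads and $q$. For every $r\in\mathrm{Rt}(G)$, $\alpha(r)$ is a root and $\mathrm{Sh}^{(G,q)}_{\alpha(r)}(v)=\mathrm{Sh}^{(G,q)}_r(v\circ\alpha)$. In particular, if $v'_G(\alpha(y))=v'_G(y)$ for all $y\in\mathrm{Desc}^G(r)$, then $\mathrm{Sh}^{(G,q)}_{\alpha(r)}(v)=\mathrm{Sh}^{(G,q)}_r(v)$. \end{enumerate} -/

import Mathlib

set_option linter.unusedSectionVars false

noncomputable section

/-- A directed acyclic multigraph: a finite set `verts` of vertices (living in an ambient type `α`),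
a finite type `E` of edges, possibly parallel, with a tail and a head vertex each, such that a
topological ordering exists. -/
structure DAMG (α : Type*) where
  verts : Finset α
  E : Type*
  finite_E : Finite E
  tail : E → verts
  head : E → verts
  acyclic : ∃ _ : LinearOrder verts, ∀ e, tail e < head e

namespace DAMG

variable {α : Type*} (G : DAMG α)

instance : Finite G.E := G.finite_E

instance : Fintype G.E := Fintype.ofFinite _

/-- The set of parents of `x`. -/
def Pa (x : G.verts) : Set G.verts := {y | ∃ e, G.tail e = y ∧ G.head e = x}

/-- There is a directed path, possibly trivial, from `x` to `y`. -/
def Reach (x y : G.verts) : Prop := Relation.ReflTransGen (fun a b => a ∈ G.Pa b) x y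

open scoped Classical in
/-- The ancestors of `x`, including `x` itself. -/
def Anc (x : G.verts) : Finset G.verts := {y | G.Reach y x}

open scoped Classical in
/-- The descendants of `x`, including `x` itself. -/
def Desc (x : G.verts) : Finset G.verts := {y | G.Reach x y}

open scoped Classical in
/-- The set of roots, as a subset of the ambient type. -/
def roots : Finset α :=
  (Finset.univ.filter fun x : G.verts => G.Pa x = ∅).map (Function.Embedding.subtype _)

theorem mem_roots {r : α} : r ∈ G.roots ↔ ∃ h : r ∈ G.verts, G.Pa ⟨r, h⟩ = ∅ := by
  simp [roots]

theorem roots_subset : G.roots ⊆ G.verts := fun _ hr => (G.mem_roots.1 hr).1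

/-- A root, seen as a vertex. -/
def rootVert (r : G.roots) : G.verts := ⟨r, G.roots_subset r.2⟩

theorem reach_lt {inst : LinearOrder G.verts} (h : ∀ e, G.tail e < G.head e) {x y : G.verts}
    (hxy : G.Reach x y) : x ≤ y := by
  induction hxy with
  | refl => exact le_rfl
  | tail _ hbc ih =>
    obtain ⟨e, rfl, rfl⟩ := hbc
    exact ih.trans (h e).le

/-- The proper ancestor relation is well-founded. -/
theorem wf_properAnc : WellFounded fun y x : G.verts => G.Reach y x ∧ y ≠ x := by
  obtain ⟨inst, h⟩ := G.acyclic
  refine Subrelation.wf (r := fun y x : G.verts => y < x) ?_ (Finite.wellFounded_of_trans_of_irrefl _)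
  intro y x hyx
  exact lt_of_le_of_ne (G.reach_lt h hyx.1) hyx.2

/-- The parent relation is well-founded. -/
theorem wf_parent : WellFounded fun y x : G.verts => y ∈ G.Pa x := by
  obtain ⟨inst, h⟩ := G.acyclic
  refine Subrelation.wf (r := fun y x : G.verts => y < x) ?_ (Finite.wellFounded_of_trans_of_irrefl _)
  rintro y x ⟨e, rfl, rfl⟩
  exact h e

section Synergy

variable {A : Type*} [AddCommGroup A]

open scoped Classical in
/-- The synergy function (Möbius transform) of a value function `v`, by recursion; see
`synergy_eq` for the recursion formula. -/
def synergy (v : G.verts → A) : G.verts → A :=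
  G.wf_properAnc.fix fun x ih =>
    v x - ∑ y : {y : G.verts // G.Reach y x ∧ y ≠ x}, ih y.1 y.2

open scoped Classical in
theorem synergy_eq (v : G.verts → A) (x : G.verts) :
    G.synergy v x = v x - ∑ y ∈ (G.Anc x).erase x, G.synergy v y := by
  rw [synergy, WellFounded.fix_eq]
  congr 1
  symm
  apply Finset.sum_subtype
  intro y
  simp [Anc, and_comm]

/-- The value function with synergy function `w` (inverse Möbius transform). -/
def sumAnc (w : G.verts → A) : G.verts → A := fun y => ∑ x ∈ G.Anc y, w x

/-- `z` is a weak element for `(G, v)`. -/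
def IsWeak (v : G.verts → A) (z : G.verts) : Prop := G.synergy v z = 0

/-- `y` is a null element for `(G, v)`. -/
def IsNull (v : G.verts → A) (y : G.verts) : Prop := ∀ x ∈ G.Desc y, G.synergy v x = 0

end Synergy

open scoped Classical in
/-- The projection of `G` onto the complement of the vertex `z`: the edges are those of `G` that
avoid `z`, together with one new edge for every pair of consecutive edges through `z`. -/
def proj (z : G.verts) : DAMG α where
  verts := G.verts.erase z
  E := {e : G.E // G.tail e ≠ z ∧ G.head e ≠ z} ⊕
    {p : G.E × G.E // (G.tail p.1 ≠ z ∧ G.head p.1 = z) ∧ (G.tail p.2 = z ∧ G.head p.2 ≠ z)}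
  finite_E := inferInstance
  tail := Sum.elim
    (fun e => ⟨G.tail e.1, Finset.mem_erase.2 ⟨fun h => e.2.1 (Subtype.ext h), (G.tail e.1).2⟩⟩)
    (fun p => ⟨G.tail p.1.1,
      Finset.mem_erase.2 ⟨fun h => p.2.1.1 (Subtype.ext h), (G.tail p.1.1).2⟩⟩)
  head := Sum.elim
    (fun e => ⟨G.head e.1, Finset.mem_erase.2 ⟨fun h => e.2.2 (Subtype.ext h), (G.head e.1).2⟩⟩)
    (fun p => ⟨G.head p.1.2,
      Finset.mem_erase.2 ⟨fun h => p.2.2.2 (Subtype.ext h), (G.head p.1.2).2⟩⟩)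
  acyclic := by
    obtain ⟨inst, h⟩ := G.acyclic
    refine ⟨LinearOrder.lift' (fun x => (⟨x.1, Finset.mem_of_mem_erase x.2⟩ : G.verts))
      (fun x y hxy => Subtype.ext (congrArg (fun t : G.verts => t.1) hxy)), ?_⟩
    rintro (⟨e, he⟩ | ⟨p, hp⟩)
    · exact h e
    · have h1 := h p.1
      have h2 := h p.2
      rw [hp.1.2] at h1
      rw [hp.2.1] at h2
      exact h1.trans h2

theorem mem_proj (z : G.verts) {x : α} : x ∈ (G.proj z).verts ↔ x ≠ z ∧ x ∈ G.verts := by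
  classical
  simp [proj]

/-- The list `l` consists of distinct vertices of `G`. -/
def IsEnum (l : List α) : Prop := l.Nodup ∧ ∀ z ∈ l, z ∈ G.verts

variable {G} in
theorem IsEnum.head {z : α} {l : List α} (h : G.IsEnum (z :: l)) : z ∈ G.verts :=
  h.2 z List.mem_cons_self

end DAMG

/-- A directed acyclic multigraph `G` with an edge weight function `q` with values in `R`. -/
structure WeightedDAMG (R α : Type*) extends DAMG α where
  q : E → R

namespace WeightedDAMG

variable {R α A : Type*} [CommRing R] [AddCommGroup A] [Module R A] (G : WeightedDAMG R α)

open scoped Classical in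
/-- The pairwise weight `q(x|y)`. -/
def pairWeight (x y : G.verts) : R := ∑ e : G.E with G.tail e = x ∧ G.head e = y, G.q e

/-- The weights are normalized, that is, `(G, q)` is an `R`-PDAMG. -/
def IsNormalized : Prop := ∀ y : G.verts, (G.Pa y).Nonempty → ∑ x, G.pairWeight x y = 1

open scoped Classical in
/-- The total path weight `s(x|y)`, by recursion on `y`; see `totalWeight_eq` for the recursion
formula. -/
def totalWeight (x : G.verts) : G.verts → R :=
  G.wf_parent.fix fun y ih =>
    if y ∉ G.Desc x then 0
    else if y = x then 1
    else ∑ z : {z : G.verts // z ∈ G.Pa y}, ih z.1 z.2 * G.pairWeight z.1 y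

open scoped Classical in
theorem totalWeight_eq (x y : G.verts) :
    G.totalWeight x y =
      if y ∉ G.Desc x then 0
      else if y = x then 1
      else ∑ z : G.verts with z ∈ G.Pa y, G.totalWeight x z * G.pairWeight z y := by
  rw [totalWeight, WellFounded.fix_eq]
  congr 2
  symm
  apply Finset.sum_subtype
  intro z
  simp

/-- The projection of `(G, q)` onto the complement of the vertex `z`: new edges get the product of
the two weights. -/
def proj (z : G.verts) : WeightedDAMG R α where
  toDAMG := G.toDAMG.proj z
  q := Sum.elim (fun e => G.q e.1) (fun p => G.q p.1.1 * G.q p.1.2)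

theorem mem_proj (z : G.verts) {x : α} : x ∈ (G.proj z).verts ↔ x ≠ z ∧ x ∈ G.verts :=
  G.toDAMG.mem_proj z

/-- A vertex of the projection, seen as a vertex of `G`. -/
def ofProj (z : G.verts) (x : (G.proj z).verts) : G.verts := ⟨x.1, ((G.mem_proj z).1 x.2).2⟩

variable {G} in
theorem isEnum_rest {z : α} {l : List α} (h : G.IsEnum (z :: l)) :
    (G.proj ⟨z, h.head⟩).IsEnum l :=
  ⟨(List.nodup_cons.1 h.1).2, fun y hy => (G.mem_proj _).2
    ⟨fun hyz => (List.nodup_cons.1 h.1).1 ((show y = z from hyz) ▸ hy), h.2 y (List.mem_cons_of_mem _ hy)⟩⟩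

/-- The projection of a synergy function `w` onto the complement of the vertex `z`. -/
def projSynergy (z : G.verts) (w : G.verts → A) : (G.proj z).verts → A := fun x =>
  w (G.ofProj z x) + G.pairWeight (G.ofProj z x) z • w z

/-- The projection of `(G, q)` onto the complement of a set of vertices, listed as `l`, by
projecting out one vertex after the other. -/
def projList : (G : WeightedDAMG R α) → (l : List α) → G.IsEnum l → WeightedDAMG R α
  | G, [], _ => G
  | G, z :: l, h => projList (G.proj ⟨z, h.head⟩) l (isEnum_rest h)

/-- The projection of a synergy function `w` onto the complement of a set of vertices, listed as
`l`, by projecting out one vertex after the other. -/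
def projListSynergy : (G : WeightedDAMG R α) → (l : List α) → (h : G.IsEnum l) →
    (G.verts → A) → (G.projList l h).verts → A
  | _, [], _, w => w
  | G, z :: l, h, w =>
    projListSynergy (G.proj ⟨z, h.head⟩) l (isEnum_rest h) (G.projSynergy ⟨z, h.head⟩ w)

/-- The projection of a value function `v`: the value function on the projected graph whose
synergy function is the projection of the synergy function of `v`. -/
def projListValue (l : List α) (h : G.IsEnum l) (v : G.verts → A) : (G.projList l h).verts → A :=
  (G.projList l h).sumAnc (G.projListSynergy l h (G.synergy v))

theorem mem_projList (G : WeightedDAMG R α) (l : List α) (h : G.IsEnum l) {x : α} :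
    x ∈ (G.projList l h).verts ↔ x ∈ G.verts ∧ x ∉ l := by
  induction l generalizing G with
  | nil => simp [projList]
  | cons z l ih =>
    rw [projList, ih, mem_proj, List.mem_cons]
    tauto

/-- The restriction of a value function `v` to the vertices of the projected graph. -/
def restrictList (l : List α) (h : G.IsEnum l) (v : G.verts → A) : (G.projList l h).verts → A :=
  fun x => v ⟨x.1, ((G.mem_projList l h).1 x.2).1⟩

/-- The list `l` enumerates the non-root vertices of `G`, without repetition. -/
def IsNonrootEnum (l : List α) : Prop := l.Nodup ∧ ∀ z, z ∈ l ↔ z ∈ G.verts ∧ z ∉ G.roots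

variable {G} in
theorem IsNonrootEnum.isEnum {l : List α} (h : G.IsNonrootEnum l) : G.IsEnum l :=
  ⟨h.1, fun z hz => ((h.2 z).1 hz).1⟩

variable {G} in
theorem IsNonrootEnum.root_mem {l : List α} (h : G.IsNonrootEnum l) (r : G.roots) :
    r.1 ∈ (G.projList l h.isEnum).verts :=
  (G.mem_projList l h.isEnum).2 ⟨G.roots_subset r.2, fun hr => ((h.2 _).1 hr).2 r.2⟩

/-- Some enumeration of the non-root vertices. -/
def nonrootList : List α := by
  classical exact (G.verts \ G.roots).toList

theorem isNonrootEnum_nonrootList : G.IsNonrootEnum G.nonrootList := by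
  classical
  exact ⟨Finset.nodup_toList _, fun z => by simp [nonrootList]⟩

/-- The Shapley value of the root `r`: the projection of the synergy function onto the set of
roots, evaluated at `r`. -/
def shapley (v : G.verts → A) (r : G.roots) : A :=
  G.projListSynergy G.nonrootList G.isNonrootEnum_nonrootList.isEnum (G.synergy v)
    ⟨r.1, G.isNonrootEnum_nonrootList.root_mem r⟩

/-- An automorphism of `(G, q)`. -/
structure Aut where
  onVerts : G.verts ≃ G.verts
  onEdges : G.E ≃ G.E
  tail_eq : ∀ e, G.tail (onEdges e) = onVerts (G.tail e)
  head_eq : ∀ e, G.head (onEdges e) = onVerts (G.head e)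
  q_eq : ∀ e, G.q (onEdges e) = G.q e

end WeightedDAMG

end

/-! Everything follows from one invariant: for `x ≠ z`, the sum over `y` of `s(x|y) • w(y)` is
unchanged when `z` is projected out (`sum_totalWeight_smul_proj`). Splitting paths at `z` shows that
the weights `s` between surviving vertices are unchanged (`totalWeight_proj`). The lost term `s(x|z)
• w(z)` is recovered because `s(x|z)` is the sum of `s(x|y) q(y|z)` and each `y` receives `q(y|z) •
w(z)`. Once all non-roots are gone, only roots remain; there `s(r|r') = 0` for `r' ≠ r`, so the
invariant is the projected synergy at `r`. Hence the Shapley value is the sum of `s(r|y) • v'(y)` in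
any order of projection (`projListSynergy_root`). Linearity, null roots and symmetry are read off
this formula; efficiency also uses that the `s(r|y)` sum to 1 over the roots, which is where
normalization enters. -/

namespace DAMG

variable {α : Type*} (G : DAMG α)

theorem tail_ne_head (e : G.E) : G.tail e ≠ G.head e := by
  obtain ⟨inst, h⟩ := G.acyclic
  exact (h e).ne

theorem ne_of_mem_Pa {x y : G.verts} (h : x ∈ G.Pa y) : x ≠ y := by
  obtain ⟨e, rfl, rfl⟩ := h
  exact G.tail_ne_head e

theorem mem_Anc {x y : G.verts} : y ∈ G.Anc x ↔ G.Reach y x := by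
  simp [Anc]

theorem mem_Desc {x y : G.verts} : y ∈ G.Desc x ↔ G.Reach x y := by
  simp [Desc]

theorem self_mem_Anc (x : G.verts) : x ∈ G.Anc x := G.mem_Anc.2 Relation.ReflTransGen.refl

theorem vert_mem_roots {x : G.verts} : x.1 ∈ G.roots ↔ G.Pa x = ∅ := by
  rw [mem_roots]
  exact ⟨fun ⟨_, h⟩ => h, fun h => ⟨x.2, h⟩⟩

theorem Pa_rootVert (r : G.roots) : G.Pa (G.rootVert r) = ∅ :=
  G.vert_mem_roots.1 r.2

theorem Pa_nonempty_of_not_mem_roots {x : G.verts} (h : x.1 ∉ G.roots) : (G.Pa x).Nonempty := by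
  rwa [Set.nonempty_iff_ne_empty, Ne, ← vert_mem_roots]

/-! ### Möbius inversion between value functions and synergy functions. -/

section Synergy

variable {A : Type*} [AddCommGroup A]

theorem sumAnc_eq_add (w : G.verts → A) (x : G.verts) [DecidableEq G.verts] :
    G.sumAnc w x = w x + ∑ y ∈ (G.Anc x).erase x, w y :=
  (Finset.add_sum_erase _ _ (G.self_mem_Anc x)).symm

theorem sumAnc_synergy (v : G.verts → A) : G.sumAnc (G.synergy v) = v := by
  classical
  funext x
  rw [sumAnc_eq_add, synergy_eq]
  convert sub_add_cancel _ _

theorem sumAnc_injective : Function.Injective (G.sumAnc (A := A)) := by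
  classical
  intro w w' h
  funext x
  induction x using G.wf_properAnc.induction with
  | _ x ih =>
    have hx := congrFun h x
    rw [sumAnc_eq_add, sumAnc_eq_add] at hx
    rw [Finset.sum_congr rfl fun y hy => ih y
      ⟨G.mem_Anc.1 (Finset.mem_of_mem_erase hy), Finset.ne_of_mem_erase hy⟩] at hx
    exact add_right_cancel hx

/-- Lets a synergy function be identified by summing a candidate over ancestors, without unfolding
the recursion. -/
theorem synergy_eq_iff {v w : G.verts → A} : G.synergy v = w ↔ G.sumAnc w = v := by
  constructor
  · rintro rfl
    exact G.sumAnc_synergy v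
  · rintro rfl
    exact G.sumAnc_injective (G.sumAnc_synergy _)

theorem synergy_sumAnc (w : G.verts → A) : G.synergy (G.sumAnc w) = w :=
  G.synergy_eq_iff.2 rfl

end Synergy

end DAMG

namespace WeightedDAMG

variable {R α A : Type*} [CommRing R] [AddCommGroup A] [Module R A] (G : WeightedDAMG R α)

theorem synergy_linear (c₁ c₂ : R) (v₁ v₂ : G.verts → A) :
    G.synergy (c₁ • v₁ + c₂ • v₂) = c₁ • G.synergy v₁ + c₂ • G.synergy v₂ := by
  rw [DAMG.synergy_eq_iff]
  funext x
  have h₁ := congrFun (G.sumAnc_synergy v₁) x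
  have h₂ := congrFun (G.sumAnc_synergy v₂) x
  simp only [DAMG.sumAnc] at h₁ h₂
  simp [DAMG.sumAnc, Finset.sum_add_distrib, ← Finset.smul_sum, h₁, h₂]

theorem synergy_sum_smul {ι : Type*} (I : Finset ι) (a : ι → A) (u : ι → G.verts → R) :
    G.synergy (fun x => ∑ i ∈ I, u i x • a i) = fun x => ∑ i ∈ I, G.synergy (u i) x • a i := by
  rw [DAMG.synergy_eq_iff]
  funext x
  simp only [DAMG.sumAnc]
  rw [Finset.sum_comm]
  refine Finset.sum_congr rfl fun i _ => ?_
  rw [← Finset.sum_smul]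
  exact congrArg (· • a i) (congrFun (G.sumAnc_synergy (u i)) x)

/-! ### Total path weights. -/

theorem pairWeight_eq_zero {x y : G.verts} (h : x ∉ G.Pa y) : G.pairWeight x y = 0 := by
  classical
  refine Finset.sum_eq_zero fun e he => absurd ?_ h
  exact ⟨e, (Finset.mem_filter.1 he).2⟩

theorem pairWeight_self (x : G.verts) : G.pairWeight x x = 0 :=
  G.pairWeight_eq_zero fun h => G.ne_of_mem_Pa h rfl

theorem totalWeight_eq_zero {x y : G.verts} (h : y ∉ G.Desc x) : G.totalWeight x y = 0 := by
  rw [totalWeight_eq, if_pos h]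

theorem totalWeight_self (x : G.verts) : G.totalWeight x x = 1 := by
  rw [totalWeight_eq, if_neg (not_not.2 (G.mem_Desc.2 Relation.ReflTransGen.refl)), if_pos rfl]

/-- The reachability test can be dropped: non-parents have pair weight 0, and if `y` is not a
descendant of `x` then neither is any parent of `y`, so both sides vanish. -/
theorem totalWeight_of_ne {x y : G.verts} (h : y ≠ x) :
    G.totalWeight x y = ∑ z, G.totalWeight x z * G.pairWeight z y := by
  classical
  have key : ∑ z, G.totalWeight x z * G.pairWeight z y =
      ∑ z : G.verts with z ∈ G.Pa y, G.totalWeight x z * G.pairWeight z y := by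
    refine (Finset.sum_filter_of_ne fun z _ hz => ?_).symm
    by_contra hzy
    exact hz (by rw [G.pairWeight_eq_zero hzy, mul_zero])
  by_cases hd : y ∈ G.Desc x
  · rw [totalWeight_eq, if_neg (not_not.2 hd), if_neg h, key]
  · rw [G.totalWeight_eq_zero hd, key]
    refine (Finset.sum_eq_zero fun z hz => ?_).symm
    rw [G.totalWeight_eq_zero, zero_mul]
    intro hzx
    exact hd (G.mem_Desc.2 ((G.mem_Desc.1 hzx).tail (Finset.mem_filter.1 hz).2))

/-- Uniqueness for the recursion, by induction along parents. It transfers path weights to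
projections and along automorphisms. -/
theorem eq_totalWeight {x : G.verts} {f : G.verts → R} (h₁ : f x = 1)
    (h : ∀ y, y ≠ x → f y = ∑ z, f z * G.pairWeight z y) : f = G.totalWeight x := by
  funext y
  induction y using G.wf_parent.induction with
  | _ y ih =>
    by_cases hy : y = x
    · rw [hy, h₁, totalWeight_self]
    · rw [h y hy, G.totalWeight_of_ne hy]
      refine Finset.sum_congr rfl fun z _ => ?_
      by_cases hz : z ∈ G.Pa y
      · rw [ih z hz]
      · rw [G.pairWeight_eq_zero hz, mul_zero, mul_zero]

theorem totalWeight_of_Pa_eq_empty {x y : G.verts} (h : G.Pa y = ∅) (hne : y ≠ x) :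
    G.totalWeight x y = 0 := by
  rw [G.totalWeight_of_ne hne]
  refine Finset.sum_eq_zero fun z _ => ?_
  rw [G.pairWeight_eq_zero (by simp [h]), mul_zero]

/-- Induction along parents: at a non-root the sum is a `q`-weighted combination of the parents'
sums, all 1, and the coefficients sum to 1. -/
theorem sum_roots_totalWeight (hq : G.IsNormalized) (y : G.verts) :
    ∑ r : G.roots, G.totalWeight (G.rootVert r) y = 1 := by
  induction y using G.wf_parent.induction with
  | _ y ih =>
    by_cases hy : G.Pa y = ∅
    · rw [Fintype.sum_eq_single (⟨y.1, G.vert_mem_roots.2 hy⟩ : G.roots)]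
      · exact G.totalWeight_self y
      · intro r hr
        refine G.totalWeight_of_Pa_eq_empty hy fun h => hr (Subtype.ext ?_)
        exact (congrArg Subtype.val h).symm
    · have hne : ∀ r : G.roots, y ≠ G.rootVert r := fun r h => hy (h ▸ G.Pa_rootVert r)
      rw [Finset.sum_congr rfl fun r _ => G.totalWeight_of_ne (hne r), Finset.sum_comm,
        ← hq y (Set.nonempty_iff_ne_empty.2 hy)]
      refine Finset.sum_congr rfl fun z _ => ?_
      rw [← Finset.sum_mul]
      by_cases hz : z ∈ G.Pa y
      · rw [ih z hz, one_mul]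
      · rw [G.pairWeight_eq_zero hz, mul_zero]

/-! ### Projecting out one vertex. -/

section Projection

variable (z : G.verts)

/-- A vertex other than `z`, seen as a vertex of the projection. -/
def toProj (x : G.verts) (h : x ≠ z) : (G.proj z).verts :=
  ⟨x.1, (G.mem_proj z).2 ⟨fun hx => h (Subtype.ext hx), x.2⟩⟩

theorem ofProj_injective : Function.Injective (G.ofProj z) := fun _ _ h =>
  Subtype.ext (congrArg (fun t : G.verts => t.1) h)

theorem ofProj_ne (x : (G.proj z).verts) : G.ofProj z x ≠ z := fun h =>
  ((G.mem_proj z).1 x.2).1 (congrArg Subtype.val h)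

theorem sum_ofProj_add {M : Type*} [AddCommMonoid M] (f : G.verts → M) :
    ∑ x, f (G.ofProj z x) + f z = ∑ x, f x := by
  classical
  rw [← Finset.sum_erase_add _ _ (Finset.mem_univ z)]
  congr 1
  refine Finset.sum_bij (fun x _ => G.ofProj z x) (fun x _ => ?_)
    (fun x _ y _ h => G.ofProj_injective z h) (fun x hx => ?_) fun _ _ => rfl
  · exact Finset.mem_erase.2 ⟨G.ofProj_ne z x, Finset.mem_univ _⟩
  · exact ⟨G.toProj z x (Finset.ne_of_mem_erase hx), Finset.mem_univ _, rfl⟩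

theorem mem_Pa_proj {x y : (G.proj z).verts} :
    x ∈ (G.proj z).Pa y ↔ G.ofProj z x ∈ G.Pa (G.ofProj z y) ∨
      (G.ofProj z x ∈ G.Pa z ∧ z ∈ G.Pa (G.ofProj z y)) := by
  constructor
  · rintro ⟨e | p, rfl, rfl⟩
    · exact Or.inl ⟨e.1, rfl, rfl⟩
    · exact Or.inr ⟨⟨p.1.1, rfl, p.2.1.2⟩, ⟨p.1.2, p.2.2.1, rfl⟩⟩
  · rintro (⟨e, h₁, h₂⟩ | ⟨⟨e, h₁, h₂⟩, ⟨f, h₃, h₄⟩⟩)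
    · exact ⟨Sum.inl ⟨e, h₁ ▸ G.ofProj_ne z x, h₂ ▸ G.ofProj_ne z y⟩,
        G.ofProj_injective z h₁, G.ofProj_injective z h₂⟩
    · exact ⟨Sum.inr ⟨(e, f), ⟨h₁ ▸ G.ofProj_ne z x, h₂⟩, ⟨h₃, h₄ ▸ G.ofProj_ne z y⟩⟩,
        G.ofProj_injective z h₁, G.ofProj_injective z h₄⟩

theorem reach_proj {x y : (G.proj z).verts} :
    (G.proj z).Reach x y ↔ G.Reach (G.ofProj z x) (G.ofProj z y) := by
  constructor
  · intro h
    induction h with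
    | refl => exact Relation.ReflTransGen.refl
    | tail _ h ih =>
      rcases (G.mem_Pa_proj z).1 h with h | ⟨h₁, h₂⟩
      · exact ih.tail h
      · exact (ih.tail h₁).tail h₂
  · intro h
    -- A path may stop at `z`, which has no counterpart in the projection; the induction then
    -- remembers a parent `p` of `z` already reached, from which a new edge bypasses `z`.
    have key : ∀ u, G.Reach (G.ofProj z x) u →
        (∀ hu : u ≠ z, (G.proj z).Reach x (G.toProj z u hu)) ∧
        (u = z → ∃ p, G.ofProj z p ∈ G.Pa z ∧ (G.proj z).Reach x p) := by
      intro u hu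
      induction hu with
      | refl => exact ⟨fun _ => Relation.ReflTransGen.refl, fun h => absurd h (G.ofProj_ne z x)⟩
      | @tail b c _ hbc ih =>
        by_cases hb : b = z
        · subst hb
          refine ⟨fun hc => ?_, fun hc => absurd hc (G.ne_of_mem_Pa hbc).symm⟩
          obtain ⟨p, hp, hxp⟩ := ih.2 rfl
          exact hxp.tail ((G.mem_Pa_proj b).2 (Or.inr ⟨hp, hbc⟩))
        · refine ⟨fun hc => (ih.1 hb).tail ((G.mem_Pa_proj z).2 (Or.inl hbc)), ?_⟩
          rintro rfl
          exact ⟨G.toProj c b hb, hbc, ih.1 hb⟩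
    exact (key _ h).1 (G.ofProj_ne z y)

theorem sumAnc_proj (w : G.verts → A) (hw : w z = 0) (x : (G.proj z).verts) :
    (G.proj z).sumAnc (G.projSynergy z w) x = G.sumAnc w (G.ofProj z x) := by
  classical
  have h₁ : (G.proj z).sumAnc (G.projSynergy z w) x =
      ∑ y, if G.Reach (G.ofProj z y) (G.ofProj z x) then w (G.ofProj z y) else 0 := by
    simp only [DAMG.sumAnc, DAMG.Anc, Finset.sum_filter, reach_proj, projSynergy, hw, smul_zero,
      add_zero]
  rw [h₁, DAMG.sumAnc, DAMG.Anc, Finset.sum_filter,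
    ← G.sum_ofProj_add z fun y => if G.Reach y (G.ofProj z x) then w y else 0, hw, ite_self,
    add_zero]

/-- Since `z` is not a root, a child of `z` inherits a parent of `z` and so does not become a root.
-/
theorem roots_proj (hz : z.1 ∉ G.roots) : (G.proj z).roots = G.roots := by
  ext x
  obtain ⟨p, hp⟩ := G.Pa_nonempty_of_not_mem_roots hz
  rw [DAMG.mem_roots, DAMG.mem_roots]
  constructor
  · rintro ⟨hx, h⟩
    refine ⟨((G.mem_proj z).1 hx).2, Set.eq_empty_iff_forall_notMem.2 fun y hy => ?_⟩
    by_cases hyz : y = z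
    · subst hyz
      exact Set.eq_empty_iff_forall_notMem.1 h (G.toProj y p (G.ne_of_mem_Pa hp))
        ((G.mem_Pa_proj y).2 (Or.inr ⟨hp, hy⟩))
    · exact Set.eq_empty_iff_forall_notMem.1 h (G.toProj z y hyz)
        ((G.mem_Pa_proj z).2 (Or.inl hy))
  · rintro ⟨hx, h⟩
    have hxz : x ≠ z := fun hxz => hz (hxz ▸ G.mem_roots.2 ⟨hx, h⟩)
    refine ⟨(G.mem_proj z).2 ⟨hxz, hx⟩, Set.eq_empty_iff_forall_notMem.2 fun y hy => ?_⟩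
    have h' := Set.eq_empty_iff_forall_notMem.1 h
    rcases (G.mem_Pa_proj z).1 hy with hy | ⟨-, hy⟩
    exacts [h' _ hy, h' _ hy]

theorem pairWeight_proj (x y : (G.proj z).verts) :
    (G.proj z).pairWeight x y = G.pairWeight (G.ofProj z x) (G.ofProj z y) +
      G.pairWeight (G.ofProj z x) z * G.pairWeight z (G.ofProj z y) := by
  classical
  have hx := G.ofProj_ne z x
  have hy := G.ofProj_ne z y
  have hsplit : (G.proj z).pairWeight x y =
      (∑ e : {e : G.E // G.tail e ≠ z ∧ G.head e ≠ z},
        if G.tail e.1 = G.ofProj z x ∧ G.head e.1 = G.ofProj z y then G.q e.1 else 0) +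
      ∑ p : {p : G.E × G.E //
          (G.tail p.1 ≠ z ∧ G.head p.1 = z) ∧ (G.tail p.2 = z ∧ G.head p.2 ≠ z)},
        if G.tail p.1.1 = G.ofProj z x ∧ G.head p.1.2 = G.ofProj z y
          then G.q p.1.1 * G.q p.1.2 else 0 := by
    rw [← Fintype.sum_sumElim, pairWeight, Finset.sum_filter]
    -- The projected edge type unfolds to the sum type; the identity equivalence reconciles the two
    -- `Fintype` instances.
    refine Finset.sum_equiv (Equiv.refl _)
      (fun _ => iff_of_true (Finset.mem_univ _) (Finset.mem_univ _)) ?_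
    rintro (e | p) -
    · refine if_congr ?_ rfl rfl
      rw [← (G.ofProj_injective z).eq_iff, ← (G.ofProj_injective z).eq_iff]
      rfl
    · refine if_congr ?_ rfl rfl
      rw [← (G.ofProj_injective z).eq_iff, ← (G.ofProj_injective z).eq_iff]
      rfl
  rw [hsplit]
  congr 1
  · rw [← Finset.sum_subtype (Finset.univ.filter fun e => G.tail e ≠ z ∧ G.head e ≠ z)
      (fun e => by simp)
      (fun e => if G.tail e = G.ofProj z x ∧ G.head e = G.ofProj z y then G.q e else 0),
      ← Finset.sum_filter, Finset.filter_filter, pairWeight]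
    refine Finset.sum_congr (Finset.filter_congr fun e _ => ?_) fun _ _ => rfl
    constructor
    · exact fun h => h.2
    · exact fun h => ⟨⟨h.1 ▸ hx, h.2 ▸ hy⟩, h⟩
  · rw [← Finset.sum_subtype (Finset.univ.filter fun p : G.E × G.E =>
        (G.tail p.1 ≠ z ∧ G.head p.1 = z) ∧ (G.tail p.2 = z ∧ G.head p.2 ≠ z))
      (fun p => by simp)
      (fun p => if G.tail p.1 = G.ofProj z x ∧ G.head p.2 = G.ofProj z y
        then G.q p.1 * G.q p.2 else 0),
      ← Finset.sum_filter, Finset.filter_filter, pairWeight, pairWeight, Finset.sum_mul_sum,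
      ← Finset.sum_product']
    refine Finset.sum_congr ?_ fun _ _ => rfl
    ext p
    simp only [Finset.mem_filter, Finset.mem_univ, true_and, Finset.mem_product]
    constructor
    · rintro ⟨⟨⟨_, h₁⟩, h₂, _⟩, h₃, h₄⟩
      exact ⟨⟨h₃, h₁⟩, h₂, h₄⟩
    · rintro ⟨⟨h₃, h₁⟩, h₂, h₄⟩
      exact ⟨⟨⟨h₃ ▸ hx, h₁⟩, h₂, h₄ ▸ hy⟩, h₃, h₄⟩

/-- When the bracketed sum equals `f z`, the last term is exactly the `z`-summand missing from the
first sum. This happens for `f = 1` (normalization) and for `f = s(x|·)` (path weights). -/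
theorem sum_pairWeight_proj (y : (G.proj z).verts) (f : G.verts → R) :
    ∑ x, f (G.ofProj z x) * (G.proj z).pairWeight x y =
      ∑ x, f (G.ofProj z x) * G.pairWeight (G.ofProj z x) (G.ofProj z y) +
        (∑ x, f x * G.pairWeight x z) * G.pairWeight z (G.ofProj z y) := by
  simp only [pairWeight_proj, mul_add, Finset.sum_add_distrib, ← mul_assoc, ← Finset.sum_mul]
  rw [← G.sum_ofProj_add z fun x => f x * G.pairWeight x z, pairWeight_self, mul_zero, add_zero]

theorem IsNormalized.proj {G : WeightedDAMG R α} (hq : G.IsNormalized) (z : G.verts)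
    (hz : z.1 ∉ G.roots) : (G.proj z).IsNormalized := by
  rintro y ⟨p, hp⟩
  have hy : (G.Pa (G.ofProj z y)).Nonempty := by
    rcases (G.mem_Pa_proj z).1 hp with h | ⟨-, h⟩
    exacts [⟨_, h⟩, ⟨_, h⟩]
  have h := G.sum_pairWeight_proj z y fun _ => 1
  simp only [one_mul] at h
  rw [h, hq z (G.Pa_nonempty_of_not_mem_roots hz), one_mul,
    G.sum_ofProj_add z fun x => G.pairWeight x (G.ofProj z y), hq _ hy]

theorem totalWeight_proj (x y : (G.proj z).verts) :
    (G.proj z).totalWeight x y = G.totalWeight (G.ofProj z x) (G.ofProj z y) := by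
  refine (congrFun ((G.proj z).eq_totalWeight (x := x)
    (f := fun y => G.totalWeight (G.ofProj z x) (G.ofProj z y)) ?_ ?_) y).symm
  · exact G.totalWeight_self _
  · intro y hy
    rw [G.sum_pairWeight_proj z y (G.totalWeight (G.ofProj z x)),
      ← G.totalWeight_of_ne (G.ofProj_ne z x).symm,
      G.sum_ofProj_add z fun u => G.totalWeight (G.ofProj z x) u * G.pairWeight u (G.ofProj z y),
      ← G.totalWeight_of_ne fun h => hy (G.ofProj_injective z h)]

theorem sum_totalWeight_smul_proj (x : (G.proj z).verts) (w : G.verts → A) :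
    ∑ y, (G.proj z).totalWeight x y • G.projSynergy z w y =
      ∑ y, G.totalWeight (G.ofProj z x) y • w y := by
  simp only [projSynergy, totalWeight_proj, smul_add, smul_smul, Finset.sum_add_distrib,
    ← Finset.sum_smul]
  rw [← G.sum_ofProj_add z fun y => G.totalWeight (G.ofProj z x) y • w y,
    G.totalWeight_of_ne (G.ofProj_ne z x).symm,
    ← G.sum_ofProj_add z fun y => G.totalWeight (G.ofProj z x) y * G.pairWeight y z,
    pairWeight_self, mul_zero, add_zero]

end Projection

/-! ### Iterated projection and the Shapley value. -/

theorem roots_projList (G : WeightedDAMG R α) (l : List α) (h : G.IsEnum l)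
    (hl : ∀ z ∈ l, z ∉ G.roots) : (G.projList l h).roots = G.roots := by
  induction l generalizing G with
  | nil => rfl
  | cons z l ih =>
    have hr := G.roots_proj ⟨z, h.head⟩ (hl z List.mem_cons_self)
    rw [projList, ih _ _ fun y hy => hr ▸ hl y (List.mem_cons_of_mem _ hy), hr]

theorem IsNormalized.projList {G : WeightedDAMG R α} (hq : G.IsNormalized) (l : List α)
    (h : G.IsEnum l) (hl : ∀ z ∈ l, z ∉ G.roots) : (G.projList l h).IsNormalized := by
  induction l generalizing G with
  | nil => exact hq
  | cons z l ih =>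
    have hz := hl z List.mem_cons_self
    exact ih (hq.proj ⟨z, h.head⟩ hz) _ fun y hy =>
      G.roots_proj ⟨z, h.head⟩ hz ▸ hl y (List.mem_cons_of_mem _ hy)

theorem sum_totalWeight_smul_projList (G : WeightedDAMG R α) (l : List α) (h : G.IsEnum l)
    (w : G.verts → A) (x : (G.projList l h).verts) :
    ∑ y, (G.projList l h).totalWeight x y • G.projListSynergy l h w y =
      ∑ y, G.totalWeight ⟨x.1, ((G.mem_projList l h).1 x.2).1⟩ y • w y := by
  induction l generalizing G with
  | nil => rfl
  | cons z l ih =>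
    exact (ih (G.proj ⟨z, h.head⟩) _ _ x).trans (G.sum_totalWeight_smul_proj ⟨z, h.head⟩ _ w)

theorem projListSynergy_root (l : List α) (hl : G.IsNonrootEnum l) (w : G.verts → A)
    (r : G.roots) :
    G.projListSynergy l hl.isEnum w ⟨r.1, hl.root_mem r⟩ =
      ∑ y, G.totalWeight (G.rootVert r) y • w y := by
  refine Eq.trans ?_ (G.sum_totalWeight_smul_projList l hl.isEnum w ⟨r.1, hl.root_mem r⟩)
  rw [Fintype.sum_eq_single ⟨r.1, hl.root_mem r⟩, totalWeight_self, one_smul]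
  intro y hy
  have hroots := G.roots_projList l hl.isEnum fun z hz => ((hl.2 z).1 hz).2
  have hyl := (G.mem_projList l hl.isEnum).1 y.2
  rw [totalWeight_of_Pa_eq_empty _ _ hy, zero_smul]
  -- Every vertex left after projecting out all non-roots is a root.
  rw [← DAMG.vert_mem_roots, hroots]
  by_contra hyr
  exact hyl.2 ((hl.2 _).2 ⟨hyl.1, hyr⟩)

theorem shapley_eq_sum (v : G.verts → A) (r : G.roots) :
    G.shapley v r = ∑ y, G.totalWeight (G.rootVert r) y • G.synergy v y :=
  G.projListSynergy_root _ G.isNonrootEnum_nonrootList _ r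

theorem shapley_projListValue (l : List α) (h : G.IsEnum l) (v : G.verts → A) {r : α}
    (hr : r ∈ G.roots) (hr' : r ∈ (G.projList l h).roots) :
    G.shapley v ⟨r, hr⟩ = (G.projList l h).shapley (G.projListValue l h v) ⟨r, hr'⟩ := by
  rw [shapley_eq_sum, shapley_eq_sum, projListValue, DAMG.synergy_sumAnc,
    sum_totalWeight_smul_projList]
  rfl

theorem sumAnc_projListSynergy (G : WeightedDAMG R α) (l : List α) (h : G.IsEnum l)
    (w : G.verts → A) (hw : ∀ z : G.verts, z.1 ∈ l → w z = 0) :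
    (G.projList l h).sumAnc (G.projListSynergy l h w) = G.restrictList l h (G.sumAnc w) := by
  induction l generalizing G with
  | nil => rfl
  | cons z l ih =>
    have hz : w ⟨z, h.head⟩ = 0 := hw _ List.mem_cons_self
    refine (ih (G.proj ⟨z, h.head⟩) _ (G.projSynergy ⟨z, h.head⟩ w) fun y hy => ?_).trans ?_
    -- As `w z = 0`, projecting merely restricts `w`, so the remaining listed vertices still have
    -- zero synergy.
    · rw [projSynergy, hz, smul_zero, add_zero]
      exact hw _ (List.mem_cons_of_mem _ hy)
    · funext x
      exact G.sumAnc_proj ⟨z, h.head⟩ w hz _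

theorem projListValue_eq_restrictList (l : List α) (h : G.IsEnum l) (v : G.verts → A)
    (hv : ∀ z : G.verts, z.1 ∈ l → G.IsWeak v z) :
    G.projListValue l h v = G.restrictList l h v := by
  rw [projListValue, G.sumAnc_projListSynergy l h _ hv, DAMG.sumAnc_synergy]

/-! ### Invariance under automorphisms. -/

namespace Aut

variable {G} (σ : G.Aut)

theorem mem_Pa {x y : G.verts} : σ.onVerts x ∈ G.Pa (σ.onVerts y) ↔ x ∈ G.Pa y := by
  constructor
  · rintro ⟨e, h₁, h₂⟩
    obtain ⟨e, rfl⟩ := σ.onEdges.surjective e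
    rw [σ.tail_eq] at h₁
    rw [σ.head_eq] at h₂
    exact ⟨e, σ.onVerts.injective h₁, σ.onVerts.injective h₂⟩
  · rintro ⟨e, rfl, rfl⟩
    exact ⟨σ.onEdges e, σ.tail_eq e, σ.head_eq e⟩

theorem reach {x y : G.verts} : G.Reach (σ.onVerts x) (σ.onVerts y) ↔ G.Reach x y := by
  constructor
  · intro h
    have h' := Relation.ReflTransGen.lift (p := fun a b => a ∈ G.Pa b) σ.onVerts.symm
      (fun a b (hab : a ∈ G.Pa b) => σ.mem_Pa.1 (by simpa using hab)) _ _ h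
    simpa [Function.onFun, DAMG.Reach] using h'
  · exact fun h => Relation.ReflTransGen.lift (p := fun a b => a ∈ G.Pa b) σ.onVerts
      (fun _ _ => σ.mem_Pa.2) _ _ h

theorem mem_roots {x : G.verts} (hx : x.1 ∈ G.roots) : (σ.onVerts x).1 ∈ G.roots := by
  rw [DAMG.vert_mem_roots] at hx ⊢
  refine Set.eq_empty_iff_forall_notMem.2 fun y hy => ?_
  obtain ⟨y, rfl⟩ := σ.onVerts.surjective y
  rw [σ.mem_Pa, hx] at hy
  exact hy

theorem pairWeight (x y : G.verts) :
    G.pairWeight (σ.onVerts x) (σ.onVerts y) = G.pairWeight x y := by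
  classical
  rw [WeightedDAMG.pairWeight, WeightedDAMG.pairWeight, Finset.sum_filter, Finset.sum_filter]
  refine (Fintype.sum_equiv σ.onEdges _ _ fun e => ?_).symm
  simp only [σ.tail_eq, σ.head_eq, σ.q_eq, EmbeddingLike.apply_eq_iff_eq]

theorem totalWeight (x y : G.verts) :
    G.totalWeight (σ.onVerts x) (σ.onVerts y) = G.totalWeight x y := by
  refine congrFun (G.eq_totalWeight (f := fun y => G.totalWeight (σ.onVerts x) (σ.onVerts y))
    (G.totalWeight_self _) fun y hy => ?_) y
  rw [G.totalWeight_of_ne (σ.onVerts.injective.ne hy)]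
  exact (Fintype.sum_equiv σ.onVerts _ _ fun z => by rw [σ.pairWeight]).symm

theorem synergy (v : G.verts → A) :
    G.synergy (fun x => v (σ.onVerts x)) = fun x => G.synergy v (σ.onVerts x) := by
  classical
  rw [DAMG.synergy_eq_iff]
  funext x
  rw [← congrFun (G.sumAnc_synergy v) (σ.onVerts x), DAMG.sumAnc, DAMG.sumAnc, DAMG.Anc, DAMG.Anc,
    Finset.sum_filter, Finset.sum_filter]
  exact Fintype.sum_equiv σ.onVerts _ _ fun y => if_congr σ.reach.symm rfl rfl

theorem shapley (v : G.verts → A) (r : G.roots)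
    (hr : (σ.onVerts (G.rootVert r)).1 ∈ G.roots) :
    G.shapley v ⟨σ.onVerts (G.rootVert r), hr⟩ =
      ∑ y, G.totalWeight (G.rootVert r) y • G.synergy v (σ.onVerts y) := by
  rw [shapley_eq_sum]
  refine (Fintype.sum_equiv σ.onVerts _ _ fun y => ?_).symm
  rw [← σ.totalWeight]
  rfl

end Aut

end WeightedDAMG

/-! ### The properties of the Shapley value, read off the path weight formula. -/

theorem mainTheorem3 {R : Type*} [CommRing R] {A : Type*} [AddCommGroup A]
    [Module R A] {α : Type*} (G : WeightedDAMG R α) (hq : G.IsNormalized)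
    (v : G.verts → A) :
    -- the projection onto the roots does not depend on the order of projections
    (∀ (l : List α) (hl : G.IsNonrootEnum l) (r : G.roots),
      G.shapley v r = G.projListSynergy l hl.isEnum (G.synergy v) ⟨r.1, hl.root_mem r⟩) ∧
    -- efficiency
    (∑ r : G.roots, G.shapley v r = ∑ x : G.verts, G.synergy v x) ∧
    -- `R`-linearity
    (∀ (c₁ c₂ : R) (v₁ v₂ : G.verts → A) (r : G.roots),
      G.shapley (c₁ • v₁ + c₂ • v₂) r = c₁ • G.shapley v₁ r + c₂ • G.shapley v₂ r) ∧
    -- `A`-linearity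
    (∀ (ι : Type*) (I : Finset ι) (a : ι → A) (u : ι → G.verts → R) (r : G.roots),
      G.shapley (fun x => ∑ i ∈ I, u i x • a i) r = ∑ i ∈ I, G.shapley (u i) r • a i) ∧
    -- null root
    (∀ r : G.roots, G.IsNull v (G.rootVert r) → G.shapley v r = 0) ∧
    -- projection, for a set of non-root vertices in any order
    (∀ (l : List α) (hl : G.IsEnum l), (∀ z ∈ l, z ∉ G.roots) →
      (G.projList l hl).IsNormalized ∧ (G.projList l hl).roots = G.roots ∧
      ∀ (r : α) (hr : r ∈ G.roots) (hr' : r ∈ (G.projList l hl).roots),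
        G.shapley v ⟨r, hr⟩ = (G.projList l hl).shapley (G.projListValue l hl v) ⟨r, hr'⟩) ∧
    -- weak elements, for a set of weak non-root vertices in any order
    (∀ (l : List α) (hl : G.IsEnum l), (∀ z ∈ l, z ∉ G.roots) →
      (∀ z : G.verts, z.1 ∈ l → G.IsWeak v z) →
      G.projListValue l hl v = G.restrictList l hl v ∧
      ∀ (r : α) (hr : r ∈ G.roots) (hr' : r ∈ (G.projList l hl).roots),
        G.shapley v ⟨r, hr⟩ = (G.projList l hl).shapley (G.restrictList l hl v) ⟨r, hr'⟩) ∧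
    -- total path weights
    (∀ r : G.roots,
      G.shapley v r = ∑ y : G.verts, G.totalWeight (G.rootVert r) y • G.synergy v y) ∧
    (∀ y : G.verts, ∑ r : G.roots, G.totalWeight (G.rootVert r) y = 1) ∧
    (∀ (r : G.roots) (y : G.verts), y ∉ G.Desc (G.rootVert r) →
      G.totalWeight (G.rootVert r) y = 0) ∧
    -- symmetry
    (∀ (σ : G.Aut) (r : G.roots), ∃ hσr : (σ.onVerts (G.rootVert r)).1 ∈ G.roots,
      G.shapley v ⟨σ.onVerts (G.rootVert r), hσr⟩ = G.shapley (fun x => v (σ.onVerts x)) r ∧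
      ((∀ y ∈ G.Desc (G.rootVert r), G.synergy v (σ.onVerts y) = G.synergy v y) →
        G.shapley v ⟨σ.onVerts (G.rootVert r), hσr⟩ = G.shapley v r)) := by
  refine ⟨fun l hl r => ?_, ?_, fun c₁ c₂ v₁ v₂ r => ?_, fun ι I a u r => ?_, fun r hr => ?_,
    fun l hl hlr => ⟨hq.projList l hl hlr, G.roots_projList l hl hlr, fun r hr hr' =>
      G.shapley_projListValue l hl v hr hr'⟩,
    fun l hl _ hw => ?_, G.shapley_eq_sum v, G.sum_roots_totalWeight hq,
    fun r y hy => G.totalWeight_eq_zero hy, fun σ r => ⟨σ.mem_roots r.2, ?_, fun h => ?_⟩⟩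
  · rw [G.shapley_eq_sum, G.projListSynergy_root l hl]
  · simp only [G.shapley_eq_sum]
    rw [Finset.sum_comm]
    refine Finset.sum_congr rfl fun y _ => ?_
    rw [← Finset.sum_smul, G.sum_roots_totalWeight hq, one_smul]
  · simp only [G.shapley_eq_sum, G.synergy_linear, Pi.add_apply, Pi.smul_apply, smul_add,
      Finset.sum_add_distrib, Finset.smul_sum, smul_comm c₁, smul_comm c₂]
  · simp only [G.shapley_eq_sum, G.synergy_sum_smul, Finset.smul_sum, Finset.sum_smul, smul_assoc]
    exact Finset.sum_comm
  · rw [G.shapley_eq_sum]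
    refine Finset.sum_eq_zero fun y _ => ?_
    by_cases hy : y ∈ G.Desc (G.rootVert r)
    · rw [hr y hy, smul_zero]
    · rw [G.totalWeight_eq_zero hy, zero_smul]
  · have h := G.projListValue_eq_restrictList l hl v hw
    exact ⟨h, fun r hr hr' => h ▸ G.shapley_projListValue l hl v hr hr'⟩
  · rw [σ.shapley, G.shapley_eq_sum, σ.synergy]
  · rw [σ.shapley, G.shapley_eq_sum]
    refine Finset.sum_congr rfl fun y _ => ?_
    -- Agreement on descendants of `r` suffices, since `s(r|y)` vanishes elsewhere.
    by_cases hy : y ∈ G.Desc (G.rootVert r)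
    · rw [h y hy]
    · rw [G.totalWeight_eq_zero hy, zero_smul, zero_smul]
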